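/- Let $(X,d)$ be a CAT(0) space, that is, a geodesic metric space in which every geodesic triangle satisfies the CAT(0) inequality (distances between points of the triangle are at most the distances between the corresponding points of a comparison triangle in the Euclidean plane). Let $\gamma:\mathbb{R}\to X$ be a geodesic line parametrized by arc length, i.e. $d(\gamma(s),\gamma(t))=|s-t|$ for all $s,t\in\mathbb{R}$; all geodesic lines below are parametrized in this way. Call a geodesic line $\sigma$ asymptotic to $\gamma$ if there is a constant $K$ with $d(\sigma(t),\gamma(t))\le K$ for all $t\in\mathbb{R}$. Then every $x\in X$ has a unique closest point $\pi(x)$ on $\gamma(\mathbb{R})$, which defines the projection $\pi:X\to\gamma(\mathbb{R})$. Let $X_\gamma\subseteq X$ be the union of the images of all geodesic lines asymptotic to $\gamma$, and let $X_\gamma^0=\{x\in X_\gamma:\pi(x)=\gamma(0)\}$. Call a subset $A$ of $X$ geodesically convex if any two points of $A$ are joined by a geodesic of $X$ and every geodesic of $X$ between two points of $A$ is contained in $A$. 1. $X_\gamma$ is geodesically convex in $X$, and $(X_\gamma,d|_{X_\gamma})$ is a CAT(0) space. 2. $X_\gamma$ is canonically isometric to $X_\gamma^0\times\mathbb{R}$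 with the product metric $d((x,t),(y,t'))=\sqrt{d(x,y)^2+|t-t'|^2}$: there is a unique surjective isometry $j:X_\gamma^0\times\mathbb{R}\to X_\gamma$ such that, for every $x\in X_\gamma^0$, the curve $t\mapsto j(x,t)$ is a geodesic line asymptotic to $\gamma$ with $j(x,0)=x$. Moreover, $X_\gamma^0$ is geodesically convex in $X$. -/

import Mathlib

/-- The Euclidean plane. -/
abbrev Plane : Type := EuclideanSpace ℝ (Fin 2)

/-- `c`, restricted to `[0, 1]`, is a (constant speed) geodesic from `x` to `y`.
The values of `c` outside `[0, 1]` are irrelevant. -/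
def IsGeodesic {X : Type*} [MetricSpace X] (c : ℝ → X) (x y : X) : Prop :=
  c 0 = x ∧ c 1 = y ∧
    ∃ v : ℝ, 0 ≤ v ∧
      ∀ s ∈ Set.Icc (0 : ℝ) 1, ∀ t ∈ Set.Icc (0 : ℝ) 1, dist (c s) (c t) = v * |s - t|

/-- Any two points of `X` are joined by a geodesic. -/
def IsGeodesicSpace (X : Type*) [MetricSpace X] : Prop :=
  ∀ x y : X, ∃ c : ℝ → X, IsGeodesic c x y

/-- `p` and `c` are the vertices and the sides of a geodesic triangle; the side `c i` joins the
vertex `p i` to the next one (indices mod 3). -/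
def IsGeodesicTriangle {X : Type*} [MetricSpace X] (p : Fin 3 → X) (c : Fin 3 → ℝ → X) : Prop :=
  ∀ i, IsGeodesic (c i) (p i) (p (i + 1))

/-- `q` lists the vertices of a Euclidean comparison triangle for a triangle with vertices `p`. -/
def IsComparisonTriangle {X : Type*} [MetricSpace X] (p : Fin 3 → X) (q : Fin 3 → Plane) : Prop :=
  ∀ i, dist (q i) (q (i + 1)) = dist (p i) (p (i + 1))

/-- The CAT(0) inequality for the triangle with vertices `p` and sides `c`: distances between points
of the triangle are at most the distances between their comparison points. The comparison point of
the point `c i s` of the `i`-th side is the point at parameter `s` of the segment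
`[q i, q (i + 1)]`. -/
def SatisfiesCAT0Inequality {X : Type*} [MetricSpace X] (p : Fin 3 → X) (c : Fin 3 → ℝ → X) :
    Prop :=
  ∀ q : Fin 3 → Plane, IsComparisonTriangle p q →
    ∀ i j : Fin 3, ∀ s ∈ Set.Icc (0 : ℝ) 1, ∀ t ∈ Set.Icc (0 : ℝ) 1,
      dist (c i s) (c j t) ≤
        dist (AffineMap.lineMap (q i) (q (i + 1)) s : Plane)
          (AffineMap.lineMap (q j) (q (j + 1)) t)

/-- A CAT(0) space: a geodesic metric space all of whose geodesic triangles satisfy the CAT(0)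
inequality. -/
def IsCAT0 (X : Type*) [MetricSpace X] : Prop :=
  IsGeodesicSpace X ∧
    ∀ (p : Fin 3 → X) (c : Fin 3 → ℝ → X), IsGeodesicTriangle p c → SatisfiesCAT0Inequality p c

/-- `A` is geodesically convex: any two points of `A` are joined by a geodesic of `X`, and every
geodesic of `X` between two points of `A` is contained in `A`. -/
def GeodesicallyConvex {X : Type*} [MetricSpace X] (A : Set X) : Prop :=
  ∀ x ∈ A, ∀ y ∈ A,
    (∃ c : ℝ → X, IsGeodesic c x y) ∧
      ∀ c : ℝ → X, IsGeodesic c x y → ∀ t ∈ Set.Icc (0 : ℝ) 1, c t ∈ A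

/-- A geodesic line, parametrized by arc length. -/
def IsGeodesicLine {X : Type*} [MetricSpace X] (σ : ℝ → X) : Prop :=
  ∀ s t : ℝ, dist (σ s) (σ t) = |s - t|

/-- Two lines are asymptotic if they stay at bounded distance. -/
def Asymptotic {X : Type*} [MetricSpace X] (σ τ : ℝ → X) : Prop :=
  ∃ K : ℝ, ∀ t : ℝ, dist (σ t) (τ t) ≤ K

/-- `p` is a projection of `x` onto `C`, that is, a point of `C` at distance `d(x, C)` from `x`. -/
def IsProjection {X : Type*} [MetricSpace X] (C : Set X) (x p : X) : Prop :=
  p ∈ C ∧ dist x p = Metric.infDist x C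

/-- The union of the images of all geodesic lines asymptotic to `γ`. -/
def parallelSet {X : Type*} [MetricSpace X] (γ : ℝ → X) : Set X :=
  {x | ∃ σ : ℝ → X, IsGeodesicLine σ ∧ Asymptotic σ γ ∧ x ∈ Set.range σ}

/-- The points of `parallelSet γ` that project to `γ 0` on the line `γ`. -/
def parallelFibre {X : Type*} [MetricSpace X] (γ : ℝ → X) : Set X :=
  {x | x ∈ parallelSet γ ∧ IsProjection (Set.range γ) x (γ 0)}

/-!
The CAT(0) condition enters through Stewart's inequality (`IsCAT0.dist_sq_le`), which bounds the
distance from a point to a point of a geodesic. Applied repeatedly, it gives the quadrilateral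
inequality (`IsCAT0.dist_sq_add_dist_sq_le`) and the convexity of the metric
(`IsCAT0.dist_le_convexCombination`).

For asymptotic lines `σ` and `τ`, the bounded convex function `r ↦ d(σ r, τ (r + a))` is constant,
so `d(σ s, τ t)` depends on `t - s` only. Stewart's inequality and the quadrilateral inequality
bound the second differences of its square from below and from above by the same quantity; hence
`d(σ s, τ t)² = (t - s - a)² + D²` for some shift `a` and width `D`. This is the flat strip theorem
(`IsCAT0.exists_isFlatStrip`), obtained without angles.

The shifts of three mutually asymptotic lines add up to zero (`IsFlatStrip.shift_eq_zero`): a path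
that goes around the three strips, advancing by a large `L` in each, has length `3 L + O(1 / L)`,
while its end points lie on one line. Therefore the lines through two points `x`, `y` of the fibre
satisfy `d(σ s, τ t)² = (t - s)² + d(x, y)²`, which is the product decomposition.

The parallel set is convex because the points at a fixed parameter of the segments `[σ r, τ r]`
trace a line asymptotic to `γ` (`IsCAT0.isGeodesicLine_of_isGeodesic`). The fibre is convex because
on the line through a point of a geodesic of the fibre, Stewart's inequality forces the shift with
respect to `γ` to vanish.
-/

section Metric

variable {X : Type*} [MetricSpace X]

/-! ### Geodesics and Euclidean comparison -/

theorem IsGeodesic.dist_eq {c : ℝ → X} {x y : X} (hc : IsGeodesic c x y) {s t : ℝ}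
    (hs : s ∈ Set.Icc (0 : ℝ) 1) (ht : t ∈ Set.Icc (0 : ℝ) 1) :
    dist (c s) (c t) = dist x y * |s - t| := by
  obtain ⟨h0, h1, v, -, hv⟩ := hc
  have hxy := hv 0 (by simp) 1 (by simp)
  rw [h0, h1] at hxy
  rw [hv s hs t ht, hxy]
  norm_num

theorem IsGeodesic.reverse {c : ℝ → X} {x y : X} (hc : IsGeodesic c x y) :
    IsGeodesic (fun t => c (1 - t)) y x := by
  obtain ⟨h0, h1, v, hv0, hv⟩ := hc
  refine ⟨by simpa using h1, by simpa using h0, v, hv0, fun s hs t ht => ?_⟩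
  rw [hv _ (Set.Icc.one_sub_mem hs) _ (Set.Icc.one_sub_mem ht),
    sub_sub_sub_cancel_left, abs_sub_comm]

theorem IsGeodesicLine.isGeodesic {σ : ℝ → X} (hσ : IsGeodesicLine σ) (a b : ℝ) :
    IsGeodesic (fun u => σ (AffineMap.lineMap a b u)) (σ a) (σ b) := by
  refine ⟨by simp, by simp, |b - a|, abs_nonneg _, fun s _ t _ => ?_⟩
  rw [hσ, ← abs_mul]
  congr 1
  simp only [AffineMap.lineMap_apply_ring']
  ring

theorem exists_isComparisonTriangle (p : Fin 3 → X) : ∃ q, IsComparisonTriangle p q := by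
  set a := dist (p 0) (p 1) with ha
  set b := dist (p 1) (p 2) with hb
  set c := dist (p 2) (p 0) with hc
  have ha0 : 0 ≤ a := dist_nonneg
  have hb0 : 0 ≤ b := dist_nonneg
  have hc0 : 0 ≤ c := dist_nonneg
  have h1 : a ≤ b + c := by
    have := dist_triangle (p 0) (p 2) (p 1)
    rw [dist_comm (p 0) (p 2), dist_comm (p 2) (p 1)] at this
    linarith
  have h2 : b ≤ a + c := by
    have := dist_triangle (p 1) (p 0) (p 2)
    rw [dist_comm (p 1) (p 0), dist_comm (p 0) (p 2)] at this
    linarith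
  have h3 : c ≤ a + b := by
    have := dist_triangle (p 2) (p 1) (p 0)
    rw [dist_comm (p 2) (p 1), dist_comm (p 1) (p 0)] at this
    linarith
  -- The abscissa of the third vertex; for `a = 0` it is `0`, as it should be.
  obtain ⟨x, hx, hxc⟩ : ∃ x : ℝ, 2 * a * x = c ^ 2 + a ^ 2 - b ^ 2 ∧ x ^ 2 ≤ c ^ 2 := by
    rcases ha0.eq_or_lt with h | h
    · have : b = c := by linarith
      exact ⟨0, by rw [← h, this]; ring, by nlinarith⟩
    · have hx : 2 * a * ((c ^ 2 + a ^ 2 - b ^ 2) / (2 * a)) = c ^ 2 + a ^ 2 - b ^ 2 := by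
        field_simp
      refine ⟨_, hx, sq_le_sq.2 ?_⟩
      rw [abs_of_nonneg hc0, abs_le]
      constructor
      · refine le_of_mul_le_mul_left ?_ (by positivity : 0 < 2 * a)
        nlinarith
      · refine le_of_mul_le_mul_left ?_ (by positivity : 0 < 2 * a)
        nlinarith
  have hy : √(c ^ 2 - x ^ 2) ^ 2 = c ^ 2 - x ^ 2 := Real.sq_sqrt (by linarith)
  refine ⟨![!₂[0, 0], !₂[a, 0], !₂[x, √(c ^ 2 - x ^ 2)]], fun i => ?_⟩
  fin_cases i
  · simp [EuclideanSpace.dist_eq, Real.dist_eq, Real.sqrt_sq ha0, ← ha]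
  · simp only [EuclideanSpace.dist_eq, Real.dist_eq, sq_abs]
    simp [← hb]
    rw [hy, Real.sqrt_eq_iff_eq_sq (by nlinarith) hb0]
    linarith
  · simp only [EuclideanSpace.dist_eq, Real.dist_eq, sq_abs]
    simp [← hc]
    rw [hy, Real.sqrt_eq_iff_eq_sq (by nlinarith) hc0]
    ring

/-- Stewart's theorem in the plane. -/
theorem Plane.dist_lineMap_sq (p q r : Plane) (s : ℝ) :
    dist p (AffineMap.lineMap q r s) ^ 2 =
      (1 - s) * dist p q ^ 2 + s * dist p r ^ 2 - s * (1 - s) * dist q r ^ 2 := by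
  simp only [EuclideanSpace.dist_sq_eq, Fin.sum_univ_two, Real.dist_eq, sq_abs,
    AffineMap.lineMap_apply, vsub_eq_sub, vadd_eq_add, PiLp.add_apply, PiLp.smul_apply,
    PiLp.sub_apply, smul_eq_mul]
  ring

/-! ### Convexity of the distance in CAT(0) spaces -/

/-- The CAT(0) inequality for a vertex and a point of the opposite side, with the comparison
distance written out by Stewart's theorem. -/
theorem IsCAT0.dist_sq_le (hX : IsCAT0 X) {c : ℝ → X} {y z : X} (hc : IsGeodesic c y z) (x : X)
    {s : ℝ} (hs : s ∈ Set.Icc (0 : ℝ) 1) :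
    dist x (c s) ^ 2 ≤
      (1 - s) * dist x y ^ 2 + s * dist x z ^ 2 - s * (1 - s) * dist y z ^ 2 := by
  obtain ⟨e, he⟩ := hX.1 x y
  obtain ⟨f, hf⟩ := hX.1 z x
  obtain ⟨q, hq⟩ := exists_isComparisonTriangle ![x, y, z]
  have htri : IsGeodesicTriangle ![x, y, z] ![e, c, f] := by
    intro i
    fin_cases i
    exacts [he, hc, hf]
  have key := hX.2 _ _ htri q hq 0 1 0 (by simp) s hs
  have h0 : dist (q 0) (q 1) = dist x y := hq 0
  have h1 : dist (q 1) (q 2) = dist y z := hq 1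
  have h2 : dist (q 2) (q 0) = dist z x := hq 2
  have key' : dist x (c s) ≤ dist (q 0) (AffineMap.lineMap (q 1) (q 2) s) := by
    rw [AffineMap.lineMap_apply_zero] at key
    rw [← he.1]
    exact key
  calc dist x (c s) ^ 2 ≤ dist (q 0) (AffineMap.lineMap (q 1) (q 2) s) ^ 2 := by gcongr
    _ = _ := by rw [Plane.dist_lineMap_sq, h0, h1, dist_comm (q 0) (q 2), h2, dist_comm z x]

/-- The quadrilateral inequality, obtained by comparing `y` and `w` with the midpoint of the
diagonal from `x` to `z`. -/
theorem IsCAT0.dist_sq_add_dist_sq_le (hX : IsCAT0 X) (x y z w : X) :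
    dist x z ^ 2 + dist y w ^ 2 ≤
      dist x y ^ 2 + dist y z ^ 2 + dist z w ^ 2 + dist w x ^ 2 := by
  obtain ⟨c, hc⟩ := hX.1 x z
  have hs : (1 / 2 : ℝ) ∈ Set.Icc (0 : ℝ) 1 := by norm_num
  have hy := hX.dist_sq_le hc y hs
  have hw := hX.dist_sq_le hc w hs
  have htri := dist_triangle_right y w (c (1 / 2))
  rw [dist_comm y x] at hy
  rw [dist_comm w z] at hw
  nlinarith [sq_nonneg (dist y (c (1 / 2)) - dist w (c (1 / 2))),
    dist_nonneg (x := y) (y := w)]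

theorem IsCAT0.dist_le_mul_of_common_source (hX : IsCAT0 X) {c e : ℝ → X} {x y z : X}
    (hc : IsGeodesic c x y) (he : IsGeodesic e x z) {t : ℝ} (ht : t ∈ Set.Icc (0 : ℝ) 1) :
    dist (c t) (e t) ≤ t * dist y z := by
  refine abs_le_of_sq_le_sq' ?_ (mul_nonneg ht.1 dist_nonneg) |>.2
  have h1 := hX.dist_sq_le he (c t) ht
  have h2 := hX.dist_sq_le hc z ht
  have h3 : dist (c t) x = dist x y * t := by
    rw [dist_comm]
    nth_rw 1 [← hc.1]
    rw [hc.dist_eq (by simp) ht, zero_sub, abs_neg, abs_of_nonneg ht.1]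
  rw [h3] at h1
  rw [dist_comm z x, dist_comm z y, dist_comm z (c t)] at h2
  nlinarith [mul_le_mul_of_nonneg_left h2 ht.1]

theorem IsCAT0.geodesic_unique (hX : IsCAT0 X) {c e : ℝ → X} {x y : X}
    (hc : IsGeodesic c x y) (he : IsGeodesic e x y) {t : ℝ} (ht : t ∈ Set.Icc (0 : ℝ) 1) :
    c t = e t := by
  simpa using hX.dist_le_mul_of_common_source hc he ht

theorem IsCAT0.dist_le_convexCombination (hX : IsCAT0 X) {c e : ℝ → X} {x y x' y' : X}
    (hc : IsGeodesic c x y) (he : IsGeodesic e x' y') {t : ℝ} (ht : t ∈ Set.Icc (0 : ℝ) 1) :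
    dist (c t) (e t) ≤ (1 - t) * dist x x' + t * dist y y' := by
  obtain ⟨f, hf⟩ := hX.1 x y'
  have h1 := hX.dist_le_mul_of_common_source hc hf ht
  have h2 := hX.dist_le_mul_of_common_source hf.reverse he.reverse
    (Set.Icc.one_sub_mem ht)
  simp only [sub_sub_cancel] at h2
  linarith [dist_triangle (c t) (f t) (e t)]

/-! ### Geodesic lines and projection to a line -/

theorem IsGeodesicLine.isometry {σ : ℝ → X} (hσ : IsGeodesicLine σ) : Isometry σ :=
  Isometry.of_dist_eq fun s t => by rw [hσ, Real.dist_eq]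

theorem IsGeodesicLine.comp_add_right {σ : ℝ → X} (hσ : IsGeodesicLine σ) (a : ℝ) :
    IsGeodesicLine (fun t => σ (t + a)) := fun s t => by
  rw [hσ, add_sub_add_right_eq_sub]

theorem Asymptotic.symm {σ τ : ℝ → X} (h : Asymptotic σ τ) : Asymptotic τ σ := by
  obtain ⟨K, hK⟩ := h
  exact ⟨K, fun t => dist_comm (σ t) (τ t) ▸ hK t⟩

theorem Asymptotic.trans {σ τ ρ : ℝ → X} (h : Asymptotic σ τ) (h' : Asymptotic τ ρ) :
    Asymptotic σ ρ := by
  obtain ⟨K, hK⟩ := h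
  obtain ⟨L, hL⟩ := h'
  exact ⟨K + L, fun t => (dist_triangle _ (τ t) _).trans (add_le_add (hK t) (hL t))⟩

theorem IsGeodesicLine.asymptotic_comp_add_right {σ : ℝ → X} (hσ : IsGeodesicLine σ) (a : ℝ) :
    Asymptotic (fun t => σ (t + a)) σ :=
  ⟨|a|, fun t => by rw [hσ, add_sub_cancel_left]⟩

theorem isProjection_range_iff {σ : ℝ → X} {x : X} {t : ℝ} :
    IsProjection (Set.range σ) x (σ t) ↔ ∀ s, dist x (σ t) ≤ dist x (σ s) := by
  constructor
  · rintro ⟨-, h⟩ s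
    exact h ▸ Metric.infDist_le_dist_of_mem (Set.mem_range_self s)
  · intro h
    refine ⟨Set.mem_range_self t, le_antisymm ?_
      (Metric.infDist_le_dist_of_mem (Set.mem_range_self t))⟩
    refine (Metric.le_infDist (Set.range_nonempty σ)).2 ?_
    rintro _ ⟨s, rfl⟩
    exact h s

theorem IsCAT0.existsUnique_isProjection (hX : IsCAT0 X) {γ : ℝ → X} (hγ : IsGeodesicLine γ)
    (x : X) : ∃! p, IsProjection (Set.range γ) x p := by
  have hcont : Continuous fun t => dist x (γ t) := continuous_const.dist hγ.isometry.continuous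
  have hlim : Filter.Tendsto (fun t => dist x (γ t)) (Filter.cocompact ℝ) Filter.atTop := by
    refine Filter.tendsto_atTop_mono (fun t => ?_)
      (Filter.tendsto_atTop_add_const_right _ (-dist x (γ 0)) tendsto_norm_cocompact_atTop)
    have h1 := hγ t 0
    have h2 := dist_triangle_left (γ t) (γ 0) x
    rw [sub_zero] at h1
    rw [Real.norm_eq_abs]
    linarith
  obtain ⟨t, ht⟩ := hcont.exists_forall_le hlim
  refine ⟨γ t, isProjection_range_iff.2 ht, ?_⟩
  rintro _ ⟨⟨s, rfl⟩, hs⟩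
  have hs' := isProjection_range_iff.1 ⟨Set.mem_range_self s, hs⟩
  -- Otherwise the midpoint of the two closest points would be closer still.
  have heq : dist x (γ s) = dist x (γ t) := le_antisymm (hs' t) (ht s)
  have hmid := hX.dist_sq_le (hγ.isGeodesic s t) x (s := 1 / 2) (by norm_num)
  have hle := pow_le_pow_left₀ dist_nonneg (ht (AffineMap.lineMap s t (1 / 2 : ℝ))) 2
  rw [heq] at hmid
  have : dist (γ s) (γ t) ^ 2 ≤ 0 := by linarith
  exact dist_eq_zero.1 (pow_eq_zero_iff two_ne_zero |>.1 (le_antisymm this (sq_nonneg _)))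

/-! ### The flat strip theorem -/

theorem ConvexOn.eq_of_forall_le {f : ℝ → ℝ} (hf : ConvexOn ℝ Set.univ f) {K : ℝ}
    (hK : ∀ t, f t ≤ K) (s t : ℝ) : f s = f t := by
  suffices h : ∀ s t, f t ≤ f s from le_antisymm (h t s) (h s t)
  intro s t
  -- `t` divides the segment from `s` to `s + r⁻¹ (t - s)` in the ratio `r : 1 - r`.
  have key : ∀ r ∈ Set.Ioo (0 : ℝ) 1, f t ≤ (1 - r) * f s + r * K := by
    intro r hr
    have h := hf.2 (Set.mem_univ s) (Set.mem_univ (s + r⁻¹ * (t - s))) (sub_nonneg.2 hr.2.le)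
      hr.1.le (by ring)
    have hr0 : r ≠ 0 := hr.1.ne'
    have e : (1 - r) • s + r • (s + r⁻¹ * (t - s)) = t := by
      simp only [smul_eq_mul]
      field_simp
      ring
    rw [e] at h
    simp only [smul_eq_mul] at h
    exact h.trans (by gcongr; exacts [hr.1.le, hK _])
  have hlim : Filter.Tendsto (fun r : ℝ => (1 - r) * f s + r * K)
      (nhdsWithin 0 (Set.Ioi 0)) (nhds (f s)) := by
    refine Filter.Tendsto.mono_left ?_ nhdsWithin_le_nhds
    have : Continuous fun r : ℝ => (1 - r) * f s + r * K := by fun_prop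
    simpa using this.tendsto 0
  refine ge_of_tendsto hlim ?_
  filter_upwards [Ioo_mem_nhdsGT (zero_lt_one' ℝ)] with r hr using key r hr

/-- `σ` and `τ` bound a flat strip of width `|D|`, in which the point of `τ` opposite to `σ s` is
`τ (s + a)`. -/
def IsFlatStrip (σ τ : ℝ → X) (a D : ℝ) : Prop :=
  ∀ s t : ℝ, dist (σ s) (τ t) ^ 2 = (t - s - a) ^ 2 + D ^ 2

theorem IsFlatStrip.symm {σ τ : ℝ → X} {a D : ℝ} (h : IsFlatStrip σ τ a D) :
    IsFlatStrip τ σ (-a) D := fun s t => by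
  rw [dist_comm, h]
  ring

theorem IsCAT0.dist_eq_dist_zero_sub (hX : IsCAT0 X) {σ τ : ℝ → X} (hσ : IsGeodesicLine σ)
    (hτ : IsGeodesicLine τ) (h : Asymptotic σ τ) (s t : ℝ) :
    dist (σ s) (τ t) = dist (σ 0) (τ (t - s)) := by
  set a := t - s with ha
  have hτ' := hτ.comp_add_right a
  have hconv : ConvexOn ℝ Set.univ fun r => dist (σ r) (τ (r + a)) := by
    refine ⟨convex_univ, fun x _ y _ u v hu hv huv => ?_⟩
    have hv' : v ∈ Set.Icc (0 : ℝ) 1 := ⟨hv, by linarith⟩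
    have := hX.dist_le_convexCombination (hσ.isGeodesic x y) (hτ'.isGeodesic x y) hv'
    obtain rfl : u = 1 - v := by linarith
    simpa only [AffineMap.lineMap_apply_module, smul_eq_mul] using this
  obtain ⟨K, hK⟩ := h.trans (hτ.asymptotic_comp_add_right a).symm
  have := hconv.eq_of_forall_le hK s 0
  simpa [ha] using this

/-- The flat strip theorem. In terms of `F r = dist (σ 0) (τ r) ^ 2`, the CAT(0) inequality makes
`F r - r ^ 2` midpoint convex and the quadrilateral inequality makes it midpoint concave. -/
theorem IsCAT0.exists_isFlatStrip (hX : IsCAT0 X) {σ τ : ℝ → X} (hσ : IsGeodesicLine σ)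
    (hτ : IsGeodesicLine τ) (h : Asymptotic σ τ) : ∃ a D, IsFlatStrip σ τ a D := by
  have hshift := hX.dist_eq_dist_zero_sub hσ hτ h
  set G : ℝ → ℝ := fun r => dist (σ 0) (τ r) ^ 2 - r ^ 2 with hG
  have hcont : Continuous G :=
    ((continuous_const.dist hτ.isometry.continuous).pow 2).sub (continuous_pow 2)
  have hmid : ∀ x y, G (midpoint ℝ x y) = midpoint ℝ (G x) (G y) := by
    intro x y
    have hm : midpoint ℝ x y = (x + y) / 2 := by
      rw [midpoint_eq_smul_add, smul_eq_mul, invOf_eq_inv]; ring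
    have hm' : midpoint ℝ (G x) (G y) = (G x + G y) / 2 := by
      rw [midpoint_eq_smul_add, smul_eq_mul, invOf_eq_inv]; ring
    rw [hm, hm']
    have h1 := hX.dist_sq_le (hτ.isGeodesic x y) (σ 0) (s := 1 / 2) (by norm_num)
    -- In this quadrilateral two opposite sides have length `|x - y| / 2`, the other two have
    -- squared length `F ((x + y) / 2)`, and the squared diagonals are `F x` and `F y`.
    have h2 := hX.dist_sq_add_dist_sq_le (σ 0) (σ ((x - y) / 2)) (τ x) (τ ((x + y) / 2))
    have e1 : AffineMap.lineMap x y (1 / 2 : ℝ) = (x + y) / 2 := by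
      rw [AffineMap.lineMap_apply_ring']; ring
    rw [e1, hτ, sq_abs] at h1
    rw [hshift ((x - y) / 2) ((x + y) / 2), hshift ((x - y) / 2) x, hσ, hτ,
      dist_comm _ (σ 0), sq_abs, sq_abs] at h2
    have e2 : (x + y) / 2 - (x - y) / 2 = y := by ring
    have e3 : x - (x - y) / 2 = (x + y) / 2 := by ring
    rw [e2, e3] at h2
    simp only [hG]
    apply le_antisymm <;> nlinarith
  have hAG : ∀ r, G r = r * (G 1 - G 0) + G 0 := by
    intro r
    have : G (AffineMap.lineMap 0 1 r) = AffineMap.lineMap (G 0) (G 1) r :=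
      (AffineMap.ofMapMidpoint G hmid hcont).apply_lineMap 0 1 r
    simpa [AffineMap.lineMap_apply_ring'] using this
  set b := (G 1 - G 0) / 2 with hb
  refine ⟨-b, dist (σ 0) (τ (-b)), fun s t => ?_⟩
  have h1 := hAG (t - s)
  have h2 := hAG (-b)
  have h3 : G 1 - G 0 = 2 * b := by rw [hb]; ring
  rw [h3] at h1 h2
  rw [hshift]
  have e1 : dist (σ 0) (τ (t - s)) ^ 2 = G (t - s) + (t - s) ^ 2 := by simp [hG]
  have e2 : dist (σ 0) (τ (-b)) ^ 2 = G (-b) + (-b) ^ 2 := by simp [hG]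
  rw [e1, e2, h1, h2]
  ring

theorem IsCAT0.eq_of_asymptotic (hX : IsCAT0 X) {σ τ : ℝ → X} (hσ : IsGeodesicLine σ)
    (hτ : IsGeodesicLine τ) (h : Asymptotic σ τ) (h0 : σ 0 = τ 0) : σ = τ := by
  funext t
  rw [← dist_eq_zero, hX.dist_eq_dist_zero_sub hσ hτ h, sub_self, h0, dist_self]

theorem le_add_div_of_sq_le {d L C : ℝ} (hL : 0 < L) (hC : 0 ≤ C) (h : d ^ 2 ≤ L ^ 2 + C) :
    d ≤ L + C / L := by
  refine abs_le_of_sq_le_sq' ?_ (by positivity) |>.2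
  have : (L + C / L) ^ 2 = L ^ 2 + 2 * C + (C / L) ^ 2 := by
    field_simp
    ring
  nlinarith [sq_nonneg (C / L)]

theorem nonpos_of_forall_le_div {A C : ℝ} (h : ∀ L : ℝ, 0 < L → A ≤ C / L) : A ≤ 0 :=
  ge_of_tendsto (tendsto_const_nhds.div_atTop Filter.tendsto_id)
    ((Filter.eventually_gt_atTop 0).mono h)

theorem IsFlatStrip.add_add_nonpos {σ₁ σ₂ σ₃ : ℝ → X} (h₁ : IsGeodesicLine σ₁)
    {a b c D E F : ℝ} (h₁₂ : IsFlatStrip σ₁ σ₂ a D) (h₂₃ : IsFlatStrip σ₂ σ₃ b E)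
    (h₃₁ : IsFlatStrip σ₃ σ₁ c F) : a + b + c ≤ 0 := by
  refine nonpos_of_forall_le_div (C := D ^ 2 + E ^ 2 + F ^ 2) fun L hL => ?_
  -- Go once around the three strips, advancing by `L` in each of them.
  have i₁ : dist (σ₁ 0) (σ₂ (a + L)) ≤ L + D ^ 2 / L :=
    le_add_div_of_sq_le hL (sq_nonneg D) (by rw [h₁₂]; apply le_of_eq; ring)
  have i₂ : dist (σ₂ (a + L)) (σ₃ (a + b + 2 * L)) ≤ L + E ^ 2 / L :=
    le_add_div_of_sq_le hL (sq_nonneg E) (by rw [h₂₃]; apply le_of_eq; ring)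
  have i₃ : dist (σ₃ (a + b + 2 * L)) (σ₁ (a + b + c + 3 * L)) ≤ L + F ^ 2 / L :=
    le_add_div_of_sq_le hL (sq_nonneg F) (by rw [h₃₁]; apply le_of_eq; ring)
  have htri := dist_triangle4 (σ₁ 0) (σ₂ (a + L)) (σ₃ (a + b + 2 * L)) (σ₁ (a + b + c + 3 * L))
  have hline := h₁ (a + b + c + 3 * L) 0
  rw [dist_comm, sub_zero] at hline
  have habs := le_abs_self (a + b + c + 3 * L)
  rw [add_div, add_div]
  linarith

/-- Passing to the opposite point in a strip is transitive: going around three strips brings a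
point back to itself. -/
theorem IsFlatStrip.shift_eq_zero {σ τ γ : ℝ → X} (hσ : IsGeodesicLine σ)
    (hτ : IsGeodesicLine τ) {a D E F : ℝ} (hστ : IsFlatStrip σ τ a F)
    (hσγ : IsFlatStrip σ γ 0 D) (hτγ : IsFlatStrip τ γ 0 E) : a = 0 := by
  have h1 := IsFlatStrip.add_add_nonpos hσ hστ hτγ hσγ.symm
  have h2 := IsFlatStrip.add_add_nonpos hτ hστ.symm hσγ hτγ.symm
  linarith

theorem IsCAT0.isFlatStrip_of_isFlatStrip (hX : IsCAT0 X) {σ τ γ : ℝ → X}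
    (hσ : IsGeodesicLine σ) (hτ : IsGeodesicLine τ) (h : Asymptotic σ τ) {D E : ℝ}
    (hσγ : IsFlatStrip σ γ 0 D) (hτγ : IsFlatStrip τ γ 0 E) :
    IsFlatStrip σ τ 0 (dist (σ 0) (τ 0)) := by
  obtain ⟨a, F, hF⟩ := hX.exists_isFlatStrip hσ hτ h
  obtain rfl := hF.shift_eq_zero hσ hτ hσγ hτγ
  intro s t
  rw [hF, hF]
  ring

/-! ### Convexity of the parallel set -/

/-- Between asymptotic lines `σ` and `τ`, the points at parameter `u` of the segments from `σ r` to
`τ r` trace a geodesic line. Convexity of the metric shows that this curve is 1-Lipschitz. It cannot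
be shorter, since its distances to far away points of `σ` are almost those in a flat strip, and `σ`
is a line. -/
theorem IsCAT0.isGeodesicLine_of_isGeodesic (hX : IsCAT0 X) {σ τ : ℝ → X}
    (hσ : IsGeodesicLine σ) (hτ : IsGeodesicLine τ) (h : Asymptotic σ τ) {g : ℝ → ℝ → X}
    (hg : ∀ r, IsGeodesic (g r) (σ r) (τ r)) {u : ℝ} (hu : u ∈ Set.Icc (0 : ℝ) 1) :
    IsGeodesicLine fun r => g r u := by
  obtain ⟨a, D, hD⟩ := hX.exists_isFlatStrip hσ hτ h
  have hupper : ∀ r s, dist (g r u) (g s u) ≤ |r - s| := by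
    intro r s
    have := hX.dist_le_convexCombination (hg r) (hg s) hu
    rw [hσ, hτ] at this
    linarith
  have hfar : ∀ r s, dist (σ s) (g r u) ^ 2 ≤ (r - s - u * a) ^ 2 + (u * D) ^ 2 := by
    intro r s
    have := hX.dist_sq_le (hg r) (σ s) hu
    rw [hσ, sq_abs, hD, hD] at this
    linarith
  have hlower : ∀ r s, s - r ≤ dist (g r u) (g s u) := by
    intro r s
    rw [← sub_nonpos]
    refine nonpos_of_forall_le_div (C := 2 * (u * D) ^ 2) fun L hL => ?_
    have i₁ : dist (σ (r - u * a - L)) (g r u) ≤ L + (u * D) ^ 2 / L :=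
      le_add_div_of_sq_le hL (sq_nonneg _) ((hfar _ _).trans (by apply le_of_eq; ring))
    have i₂ : dist (σ (s - u * a + L)) (g s u) ≤ L + (u * D) ^ 2 / L :=
      le_add_div_of_sq_le hL (sq_nonneg _) ((hfar _ _).trans (by apply le_of_eq; ring))
    have htri := dist_triangle4 (σ (r - u * a - L)) (g r u) (g s u) (σ (s - u * a + L))
    rw [dist_comm (g s u) (σ _), dist_comm (σ (r - u * a - L)) (σ _), hσ] at htri
    have habs := le_abs_self (s - u * a + L - (r - u * a - L))
    rw [mul_div_assoc]
    linarith
  intro r s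
  refine le_antisymm (hupper r s) (abs_le'.2 ⟨?_, ?_⟩)
  · rw [dist_comm]
    exact hlower s r
  · rw [neg_sub]
    exact hlower r s

theorem mem_parallelSet_iff {γ : ℝ → X} {x : X} :
    x ∈ parallelSet γ ↔ ∃ σ : ℝ → X, IsGeodesicLine σ ∧ Asymptotic σ γ ∧ σ 0 = x := by
  constructor
  · rintro ⟨σ, hσ, hσγ, t, rfl⟩
    exact ⟨fun s => σ (s + t), hσ.comp_add_right t,
      (hσ.asymptotic_comp_add_right t).trans hσγ, by simp⟩
  · rintro ⟨σ, hσ, hσγ, rfl⟩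
    exact ⟨σ, hσ, hσγ, 0, rfl⟩

theorem IsCAT0.geodesicallyConvex_parallelSet (hX : IsCAT0 X) (γ : ℝ → X) :
    GeodesicallyConvex (parallelSet γ) := by
  refine fun x hx y hy => ⟨hX.1 x y, fun c hc u hu => ?_⟩
  obtain ⟨σ, hσ, hσγ, rfl⟩ := mem_parallelSet_iff.1 hx
  obtain ⟨τ, hτ, hτγ, rfl⟩ := mem_parallelSet_iff.1 hy
  have hστ := hσγ.trans hτγ.symm
  choose g hg using fun r => hX.1 (σ r) (τ r)
  refine mem_parallelSet_iff.2 ⟨fun r => g r u,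
    hX.isGeodesicLine_of_isGeodesic hσ hτ hστ hg hu, Asymptotic.trans ?_ hσγ,
    hX.geodesic_unique (hg 0) hc hu⟩
  obtain ⟨K, hK⟩ := hστ
  refine ⟨K, fun t => ?_⟩
  have h1 := (hg t).dist_eq hu (t := 0) (by simp)
  rw [(hg t).1, sub_zero, abs_of_nonneg hu.1] at h1
  rw [h1]
  exact (mul_le_of_le_one_right dist_nonneg hu.2).trans (hK t)

theorem isGeodesic_coe_iff {A : Set X} {c : ℝ → A} {x y : A} :
    IsGeodesic (fun t => (c t : X)) x y ↔ IsGeodesic c x y := by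
  simp only [IsGeodesic, Subtype.coe_inj, Subtype.dist_eq]

theorem GeodesicallyConvex.isCAT0 {A : Set X} (hA : GeodesicallyConvex A) (hX : IsCAT0 X) :
    IsCAT0 A := by
  constructor
  · intro x y
    obtain ⟨⟨c, hc⟩, h⟩ := hA x x.2 y y.2
    have hmem := h c hc
    -- Outside `[0, 1]` the geodesic may leave `A`, so it is made constant there.
    refine ⟨fun t => ⟨c (Set.projIcc 0 1 zero_le_one t), hmem _ (Set.projIcc 0 1 _ t).2⟩,
      isGeodesic_coe_iff.1 ⟨?_, ?_, ?_⟩⟩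
    · simpa using hc.1
    · simpa using hc.2.1
    · obtain ⟨v, hv0, hv⟩ := hc.2.2
      refine ⟨v, hv0, fun s hs t ht => ?_⟩
      simpa only [Set.projIcc_of_mem _ hs, Set.projIcc_of_mem _ ht] using hv s hs t ht
  · intro p c hpc q hq
    exact hX.2 (fun i => (p i : X)) (fun i t => (c i t : X))
      (fun i => isGeodesic_coe_iff.2 (hpc i)) q hq

/-! ### The fibre and the product decomposition -/

theorem IsFlatStrip.isProjection {σ γ : ℝ → X} {a D : ℝ} (h : IsFlatStrip σ γ a D) (s : ℝ) :
    IsProjection (Set.range γ) (σ s) (γ (s + a)) := by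
  refine isProjection_range_iff.2 fun t => ?_
  refine abs_le_of_sq_le_sq' ?_ dist_nonneg |>.2
  rw [h, h]
  nlinarith [sq_nonneg (t - s - a)]

theorem IsFlatStrip.shift_eq_zero_of_isProjection {σ γ : ℝ → X} {a D : ℝ}
    (h : IsFlatStrip σ γ a D) (h0 : IsProjection (Set.range γ) (σ 0) (γ 0)) : a = 0 := by
  have := pow_le_pow_left₀ dist_nonneg (isProjection_range_iff.1 h0 a) 2
  rw [h, h] at this
  exact pow_eq_zero_iff two_ne_zero |>.1 (by nlinarith [sq_nonneg a])

theorem IsCAT0.mem_parallelFibre_iff (hX : IsCAT0 X) {γ : ℝ → X} (hγ : IsGeodesicLine γ) {x : X} :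
    x ∈ parallelFibre γ ↔ ∃ σ : ℝ → X, IsGeodesicLine σ ∧ Asymptotic σ γ ∧ σ 0 = x ∧
      ∃ D, IsFlatStrip σ γ 0 D := by
  constructor
  · rintro ⟨hx, hproj⟩
    obtain ⟨σ, hσ, hσγ, rfl⟩ := mem_parallelSet_iff.1 hx
    obtain ⟨a, D, hD⟩ := hX.exists_isFlatStrip hσ hγ hσγ
    obtain rfl := hD.shift_eq_zero_of_isProjection hproj
    exact ⟨σ, hσ, hσγ, rfl, D, hD⟩
  · rintro ⟨σ, hσ, hσγ, rfl, D, hD⟩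
    exact ⟨mem_parallelSet_iff.2 ⟨σ, hσ, hσγ, rfl⟩, by simpa using hD.isProjection 0⟩

theorem IsCAT0.geodesicallyConvex_parallelFibre (hX : IsCAT0 X) {γ : ℝ → X}
    (hγ : IsGeodesicLine γ) : GeodesicallyConvex (parallelFibre γ) := by
  refine fun x hx y hy => ⟨hX.1 x y, fun c hc u hu => ?_⟩
  obtain ⟨ρ, hρ, hργ, hρ0⟩ :=
    mem_parallelSet_iff.1 ((hX.geodesicallyConvex_parallelSet γ x hx.1 y hy.1).2 c hc u hu)
  obtain ⟨σ, -, -, rfl, D, hD⟩ := (hX.mem_parallelFibre_iff hγ).1 hx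
  obtain ⟨τ, -, -, rfl, E, hE⟩ := (hX.mem_parallelFibre_iff hγ).1 hy
  obtain ⟨a, F, hF⟩ := hX.exists_isFlatStrip hρ hγ hργ
  -- `dist (c u) (γ t) ^ 2` is `(t - a) ^ 2 + F ^ 2`, and it exceeds `t ^ 2` by a bounded amount.
  have hle : ∀ t, (t - a) ^ 2 + F ^ 2 ≤ t ^ 2 + (1 - u) * D ^ 2 + u * E ^ 2 := by
    intro t
    have h1 := hX.dist_sq_le hc (γ t) hu
    rw [← hρ0, dist_comm, hF, dist_comm, hD, dist_comm, hE] at h1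
    nlinarith [mul_nonneg (mul_nonneg hu.1 (sub_nonneg.2 hu.2)) (sq_nonneg (dist (σ 0) (τ 0)))]
  obtain rfl : a = 0 := by
    by_contra ha
    -- At this `t` the term `-2 * a * t` exceeds the bound by `1`.
    have := hle (-((1 - u) * D ^ 2 + u * E ^ 2 + 1) / (2 * a))
    have e : 2 * a * (-((1 - u) * D ^ 2 + u * E ^ 2 + 1) / (2 * a)) =
        -((1 - u) * D ^ 2 + u * E ^ 2 + 1) := by field_simp
    nlinarith [sq_nonneg a, sq_nonneg F]
  exact (hX.mem_parallelFibre_iff hγ).2 ⟨ρ, hρ, hργ, hρ0, F, hF⟩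

theorem IsCAT0.existsUnique_isometryEquiv (hX : IsCAT0 X) {γ : ℝ → X} (hγ : IsGeodesicLine γ) :
    ∃! j : WithLp 2 (parallelFibre γ × ℝ) ≃ᵢ parallelSet γ,
      ∀ x : parallelFibre γ,
        IsGeodesicLine (fun t : ℝ => (j (WithLp.toLp 2 (x, t)) : X)) ∧
        Asymptotic (fun t : ℝ => (j (WithLp.toLp 2 (x, t)) : X)) γ ∧
        (j (WithLp.toLp 2 (x, 0)) : X) = x := by
  choose ℓ hℓ hℓγ hℓ0 D hD using fun x : parallelFibre γ => (hX.mem_parallelFibre_iff hγ).1 x.2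
  let f : WithLp 2 (parallelFibre γ × ℝ) → parallelSet γ :=
    fun p => ⟨ℓ p.fst p.snd, ℓ p.fst, hℓ _, hℓγ _, _, rfl⟩
  have hf : Isometry f := by
    refine Isometry.of_dist_eq fun p q => ?_
    have h := hX.isFlatStrip_of_isFlatStrip (hℓ p.fst) (hℓ q.fst)
      ((hℓγ p.fst).trans (hℓγ q.fst).symm) (hD p.fst) (hD q.fst) p.snd q.snd
    rw [hℓ0, hℓ0, sub_zero, ← sq_abs (q.snd - p.snd), ← Real.dist_eq, dist_comm q.snd] at h
    rw [WithLp.prod_dist_eq_add (by norm_num)]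
    simp only [ENNReal.toReal_ofNat, Real.rpow_ofNat]
    rw [add_comm, Subtype.dist_eq p.fst, ← h, ← Real.sqrt_eq_rpow, Real.sqrt_sq dist_nonneg]
    rfl
  have hsurj : Function.Surjective f := by
    rintro ⟨y, hy⟩
    obtain ⟨σ, hσ, hσγ, rfl⟩ := mem_parallelSet_iff.1 hy
    obtain ⟨a, E, hE⟩ := hX.exists_isFlatStrip hσ hγ hσγ
    -- Shift `σ` so that its origin projects to `γ 0`.
    have hx : σ (-a) ∈ parallelFibre γ :=
      ⟨⟨σ, hσ, hσγ, _, rfl⟩, by simpa using hE.isProjection (-a)⟩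
    have heq : ℓ ⟨σ (-a), hx⟩ = fun t => σ (t + -a) :=
      hX.eq_of_asymptotic (hℓ _) (hσ.comp_add_right _)
        ((hℓγ _).trans ((hσ.asymptotic_comp_add_right _).trans hσγ).symm) (by simp [hℓ0])
    refine ⟨WithLp.toLp 2 (⟨σ (-a), hx⟩, a), Subtype.ext ?_⟩
    change ℓ ⟨σ (-a), hx⟩ a = σ 0
    simp [heq]
  refine ⟨⟨Equiv.ofBijective f ⟨hf.injective, hsurj⟩, hf⟩,
    fun x => ⟨hℓ x, hℓγ x, hℓ0 x⟩, fun j hj => ?_⟩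
  ext p
  obtain ⟨h1, h2, h3⟩ := hj p.fst
  exact congrFun (hX.eq_of_asymptotic h1 (hℓ p.fst) (h2.trans (hℓγ p.fst).symm)
    (h3.trans (hℓ0 p.fst).symm)) p.snd

end Metric

theorem mainTheorem4 {X : Type*} [MetricSpace X] (hX : IsCAT0 X)
    (γ : ℝ → X) (hγ : IsGeodesicLine γ) :
    -- the projection onto the line is well defined
    (∀ x : X, ∃! p : X, IsProjection (Set.range γ) x p) ∧
    -- the union of the lines asymptotic to `γ` is geodesically convex and CAT(0)
    GeodesicallyConvex (parallelSet γ) ∧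
    IsCAT0 (parallelSet γ) ∧
    -- the canonical isometry from the `ℓ²` product, sending `(x, t)` to `γ_x t`, where `γ_x` is the
    -- line asymptotic to `γ` with `γ_x 0 = x`
    (∃! j : WithLp 2 (parallelFibre γ × ℝ) ≃ᵢ parallelSet γ,
      ∀ x : parallelFibre γ,
        IsGeodesicLine (fun t : ℝ => (j (WithLp.toLp 2 (x, t)) : X)) ∧
        Asymptotic (fun t : ℝ => (j (WithLp.toLp 2 (x, t)) : X)) γ ∧
        (j (WithLp.toLp 2 (x, 0)) : X) = x) ∧
    -- the fibre is geodesically convex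
    GeodesicallyConvex (parallelFibre γ) :=
  ⟨hX.existsUnique_isProjection hγ, hX.geodesicallyConvex_parallelSet γ,
    (hX.geodesicallyConvex_parallelSet γ).isCAT0 hX, hX.existsUnique_isometryEquiv hγ,
    hX.geodesicallyConvex_parallelFibre hγ⟩
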